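/- Let $k\ge 2$, let $y_1,\dots,y_k$ be distinct real numbers, and let $(c(i,j))_{1\le i,j\le k}$ be a real matrix with $c(i,j)\ge 0$ for $i\ne j$, $c(i,i)=0$, and $q_i:=\sum_{l=1}^k c(i,l)>0$ for every $i$. Fix $i\in\{1,\dots,k\}$. For every $\Delta_t>0$ so small that $c(j,l)\Delta_t\le 1$ and $q_j\Delta_t<1$ for all $j,l$, let $(Y_n)_{n\in\mathbb N}$ be a $\{y_1,\dots,y_k\}$-valued Markov chain with $Y_0=y_i$ and transition probabilities $$\pi^\Delta(y_j,y_l)=c(j,l)\,\Delta_t\quad (j\ne l),\qquad \pi^\Delta(y_j,y_j)=1-q_j\,\Delta_t .$$ Let $X_n=\sum_{m=0}^n Y_m$, let $Z^\Delta_{n\Delta_t}=\Delta_t X_n$ for $n\in\mathbb N$, and let $(\tilde Z^\Delta_s)_{s\ge 0}$ be the continuous process obtained from it by linear interpolation between the consecutive times $n\Delta_t$ and $(n+1)\Delta_t$. Let $(R_s)_{s\ge 0}$ be the $\{y_1,\dots,y_k\}$-valued continuous-time Markov chain started at $y_i$ with jump rates $c$: when it is at $y_j$, it stays there for an exponential time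 of mean $1/q_j$ and then jumps to $y_{l}$ ($l\neq j$) with probability $c(j,l)/q_j$. Then almost every path of $R$ is integrable on bounded intervals, and, as $\Delta_t\to 0$, the process $(\tilde Z^\Delta_s)_{s\ge 0}$ converges in distribution to $\bigl(\int_0^t R_s\,ds\bigr)_{t\ge 0}$, as random elements of the space $C([0,\infty),\mathbb R)$ with the topology of uniform convergence on compact sets. -/

import Mathlib

open MeasureTheory ProbabilityTheory Filter Topology
open scoped NNReal

namespace PersistentWalk

/-- The path space `C([0,∞), ℝ)`, which Mathlib endows with the topology of uniform convergence on
compact sets, is given its Borel σ-algebra. -/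
instance pathMeasurableSpace : MeasurableSpace C(ℝ≥0, ℝ) := borel _

instance pathBorelSpace : BorelSpace C(ℝ≥0, ℝ) := ⟨rfl⟩

/-! ### The discrete-time Markov chain of increments -/

/-- The transition matrix: `c(i,j) δ` off the diagonal and `1 - (∑ l, c(i,l)) δ` on it. -/
def transitionMatrix {k : ℕ} (c : Fin k → Fin k → ℝ) (δ : ℝ) : Fin k → Fin k → ℝ :=
  fun i j => if i = j then 1 - (∑ l, c i l) * δ else c i j * δ

/-- The time steps `δ > 0` that are small enough for `transitionMatrix c δ`. -/
abbrev AdmissibleStep {k : ℕ} (c : Fin k → Fin k → ℝ) : Type :=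
  {δ : ℝ // 0 < δ ∧ (∀ i j, c i j * δ ≤ 1) ∧ ∀ i, (∑ l, c i l) * δ < 1}

/-- The time step tends to `0` (through admissible, hence positive, values). -/
def stepToZero {k : ℕ} (c : Fin k → Fin k → ℝ) : Filter (AdmissibleStep c) :=
  comap Subtype.val (𝓝 0)

/-- `Y` is a Markov chain on `{y j}` with transition probability `p i j` from `y i` to `y j`:
given `Y 0, …, Y n`, with `Y n = y i`, the conditional probability of `Y (n+1) = y j` is `p i j`.
(This is written in product form, so that histories of probability zero play no role.) -/
structure IsMarkovChain {k : ℕ} (y : Fin k → ℝ) (p : Fin k → Fin k → ℝ)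
    {Ω : Type*} [MeasurableSpace Ω] (P : Measure Ω) (Y : ℕ → Ω → ℝ) : Prop where
  measurable : ∀ n, Measurable (Y n)
  mem_states : ∀ n, ∀ᵐ ω ∂P, Y n ω ∈ Set.range y
  markov : ∀ (n : ℕ) (s : ℕ → Fin k),
    P.real {ω | ∀ m ≤ n + 1, Y m ω = y (s m)}
      = P.real {ω | ∀ m ≤ n, Y m ω = y (s m)} * p (s n) (s (n + 1))

/-! ### The rescaled, linearly interpolated walk -/

/-- The walk `X n = Y 0 + ⋯ + Y n`. -/
def walk {Ω : Type*} (Y : ℕ → Ω → ℝ) (n : ℕ) (ω : Ω) : ℝ :=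
  ∑ m ∈ Finset.range (n + 1), Y m ω

/-- The piecewise linear function on `[0,∞)` with value `x n` at each integer `n`. -/
noncomputable def linearInterp (x : ℕ → ℝ) (u : ℝ≥0) : ℝ :=
  x ⌊u⌋₊ + ((u : ℝ) - ⌊u⌋₊) * (x (⌊u⌋₊ + 1) - x ⌊u⌋₊)

theorem linearInterp_natCast (x : ℕ → ℝ) (n : ℕ) : linearInterp x n = x n := by
  simp [linearInterp]

theorem linearInterp_eq (x : ℕ → ℝ) (n : ℕ) {u : ℝ≥0} (h : u ∈ Set.Icc (n : ℝ≥0) (n + 1)) :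
    linearInterp x u = x n + ((u : ℝ) - n) * (x (n + 1) - x n) := by
  rcases h.2.lt_or_eq with h2 | h2
  · have hf : ⌊u⌋₊ = n := (Nat.floor_eq_iff (zero_le)).2 ⟨h.1, h2⟩
    rw [linearInterp, hf]
  · have hu : u = ((n + 1 : ℕ) : ℝ≥0) := by rw [h2]; push_cast; rfl
    rw [hu, linearInterp_natCast]
    push_cast
    ring

theorem continuous_linearInterp (x : ℕ → ℝ) : Continuous (linearInterp x) := by
  have h1 : ∀ n : ℕ, ContinuousOn (linearInterp x) (Set.Icc (n : ℝ≥0) (n + 1)) := by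
    intro n
    have hc : Continuous (fun u : ℝ≥0 => x n + ((u : ℝ) - n) * (x (n + 1) - x n)) := by fun_prop
    exact hc.continuousOn.congr fun u hu => linearInterp_eq x n hu
  have h2 : ∀ n : ℕ, ContinuousOn (linearInterp x) (Set.Icc (0 : ℝ≥0) (n + 1)) := by
    intro n
    induction n with
    | zero => simpa using h1 0
    | succ n ih =>
      have := ih.union_of_isClosed (h1 (n + 1)) isClosed_Icc isClosed_Icc
      push_cast at this ⊢
      rwa [Set.Icc_union_Icc_eq_Icc (zero_le) (by norm_cast; omega)] at this
  rw [continuous_iff_continuousAt]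
  intro u
  refine (h2 ⌊u⌋₊).continuousAt ?_
  have : Set.Icc (0 : ℝ≥0) (⌊u⌋₊ + 1) = Set.Iic ((⌊u⌋₊ : ℝ≥0) + 1) := by
    ext v; simp
  rw [this]
  exact Iic_mem_nhds (Nat.lt_floor_add_one u)

/-- The path of the rescaled walk: the linear interpolation of the points `(n δ, δ X n)`. -/
noncomputable def rescaledWalk {Ω : Type*} (δ : ℝ) (Y : ℕ → Ω → ℝ) (ω : Ω) : C(ℝ≥0, ℝ) where
  toFun s := linearInterp (fun n => δ * walk Y n ω) (s / δ.toNNReal)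
  continuous_toFun := (continuous_linearInterp _).comp (continuous_id.div_const _)

/-! ### The continuous-time Markov chain and its integral -/

/-- `R` is a continuous-time Markov chain on `{y j}`, started at `y i`, with jump rates `c`.
`U n` is the index of the `n`-th visited state and `H n` the time spent there. The identity
`law` says that `U` is a Markov chain started at `i` that jumps from `j` to `j'` with probability
`c(j,j') / ∑ l, c(j,l)`, and that, given `U`, the `H n` are independent and `H n` is exponential
of rate `∑ l, c(U n, l)`, that is, of mean `1 / ∑ l, c(U n, l)`. -/
structure IsJumpProcess {k : ℕ} (y : Fin k → ℝ) (c : Fin k → Fin k → ℝ) (i : Fin k)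
    {Ω : Type*} [MeasurableSpace Ω] (P : Measure Ω) (R : ℝ≥0 → Ω → ℝ) : Prop where
  measurable : ∀ t, Measurable (R t)
  exists_jump_chain : ∃ (U : ℕ → Ω → Fin k) (H : ℕ → Ω → ℝ),
    (∀ n, Measurable (U n)) ∧ (∀ n, Measurable (H n)) ∧
    (∀ (n : ℕ) (s : ℕ → Fin k) (t : ℕ → ℝ), (∀ m, 0 ≤ t m) →
      P.real {ω | ∀ m ≤ n, U m ω = s m ∧ t m < H m ω}
        = (if s 0 = i then 1 else 0)
          * (∏ m ∈ Finset.range n, c (s m) (s (m + 1)) / ∑ l, c (s m) l)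
          * ∏ m ∈ Finset.range (n + 1), Real.exp (-(∑ l, c (s m) l) * t m)) ∧
    (∀ᵐ ω ∂P, ∀ (n : ℕ) (t : ℝ≥0),
      ∑ m ∈ Finset.range n, H m ω ≤ t → t < ∑ m ∈ Finset.range (n + 1), H m ω →
        R t ω = y (U n ω))

open Classical in
/-- The continuous path `t ↦ ∫₀ᵗ r(s) ds` of a function `r` on `[0,∞)` that is integrable on
bounded intervals (and the zero path if `r` is not such a function). -/
noncomputable def integralPath (r : ℝ≥0 → ℝ) : C(ℝ≥0, ℝ) :=
  if h : ∀ a b : ℝ, IntervalIntegrable (fun s : ℝ => r s.toNNReal) volume a b then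
    { toFun := fun t => ∫ s in (0 : ℝ)..t, r s.toNNReal
      continuous_toFun :=
        (intervalIntegral.continuous_primitive h 0).comp NNReal.continuous_coe }
  else 0

end PersistentWalk

namespace PersistentWalk

/-! The proof is a coupling: for every time step `δ`, a copy of the discrete chain is built on the
probability space of `R`, and its rescaled walk converges almost surely. An exponential variable of
rate `q`, divided by `-log (1 - q δ) / q` and rounded up, is exactly geometric with success
probability `q δ`. Rounding each holding time `H m` in this way, with `q` the exit rate of the state
`U m`, while keeping the visited states, therefore gives a chain that leaves `j` at each step with
probability `q_j δ` and then moves to `l` with probability `c j l / q_j`. These are the transition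
probabilities of `transitionMatrix c δ`, as shown in `measureReal_discretizedChain`. Since prefix
probabilities determine the law of a sequence, the rescaled walk of this copy has the law of the
given one (`identDistrib_rescaledWalk`).

On a fixed path, the rounding unit is asymptotic to `δ`, so the rounded holding times multiplied by
`δ` tend to the true ones. At every time that is not a jump time, the discrete chain is eventually
in the state of `R`. The interpolated walk is, up to a term of size `O(δ)`, the integral of the
discrete chain, so dominated convergence gives uniform convergence on compact sets
(`tendsto_rescaledWalk`). This requires that the jump chain does not explode
(`ae_tendsto_sum_holding`), which holds because the finitely many exit rates are bounded. -/

/-! ### Jump chains: positive holding times, distinct consecutive states, non-explosion. -/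

/-- The total jump rate out of the state `j`. -/
def exitRate {k : ℕ} (c : Fin k → Fin k → ℝ) (j : Fin k) : ℝ := ∑ l, c j l

/-- The probability that a jump chain started at `i` visits the states `s 0, …, s n` in this
order. -/
noncomputable def pathWeight {k : ℕ} (c : Fin k → Fin k → ℝ) (i : Fin k) (s : ℕ → Fin k)
    (n : ℕ) : ℝ :=
  (if s 0 = i then 1 else 0) * ∏ m ∈ Finset.range n, c (s m) (s (m + 1)) / exitRate c (s m)

/-- The visited states `U` and holding times `H` of a continuous-time Markov chain with jump
rates `c`, started at `i`. -/
structure IsJumpChain {k : ℕ} (c : Fin k → Fin k → ℝ) (i : Fin k) {Ω : Type*}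
    [MeasurableSpace Ω] (P : Measure Ω) (U : ℕ → Ω → Fin k) (H : ℕ → Ω → ℝ) : Prop where
  measurable_state : ∀ n, Measurable (U n)
  measurable_holding : ∀ n, Measurable (H n)
  law : ∀ (n : ℕ) (s : ℕ → Fin k) (t : ℕ → ℝ), (∀ m, 0 ≤ t m) →
    P.real {ω | ∀ m ≤ n, U m ω = s m ∧ t m < H m ω}
      = pathWeight c i s n * ∏ m ∈ Finset.range (n + 1), Real.exp (-exitRate c (s m) * t m)

theorem pathWeight_succ {k : ℕ} (c : Fin k → Fin k → ℝ) (i : Fin k) (s : ℕ → Fin k) (n : ℕ) :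
    pathWeight c i s (n + 1)
      = pathWeight c i s n * (c (s n) (s (n + 1)) / exitRate c (s n)) := by
  rw [pathWeight, pathWeight, Finset.prod_range_succ, mul_assoc]

theorem pathWeight_congr {k : ℕ} (c : Fin k → Fin k → ℝ) (i : Fin k) {s s' : ℕ → Fin k} {n : ℕ}
    (h : ∀ m ≤ n, s m = s' m) : pathWeight c i s n = pathWeight c i s' n := by
  rw [pathWeight, pathWeight, h 0 (Nat.zero_le n)]
  congr 1
  refine Finset.prod_congr rfl fun m hm => ?_
  have := Finset.mem_range.1 hm
  rw [h m (by omega), h (m + 1) (by omega)]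

/-- A property holds almost everywhere if it does so on every event that prescribes the first
`n + 1` values of a process with countably many states. -/
theorem ae_of_forall_prefix {Ω S : Type*} [MeasurableSpace Ω] [Countable S] {P : Measure Ω}
    (U : ℕ → Ω → S) (n : ℕ) {p : Ω → Prop}
    (h : ∀ s : ℕ → S, ∀ᵐ ω ∂P, (∀ m ≤ n, U m ω = s m) → p ω) : ∀ᵐ ω ∂P, p ω := by
  -- There are uncountably many sequences `ℕ → S` but only countably many prefixes. The index `min m
  -- n` extends a prefix to a sequence whose values beyond `n` play no role.
  have h' : ∀ᵐ ω ∂P, ∀ s : Fin (n + 1) → S,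
      (∀ m ≤ n, U m ω = s ⟨min m n, by omega⟩) → p ω :=
    ae_all_iff.2 fun s => h fun m => s ⟨min m n, by omega⟩
  filter_upwards [h'] with ω hω
  refine hω (fun m => U m ω) fun m hm => ?_
  simp [min_eq_left hm]

/-- A conditional bound given each prefix of a finite-state process is an unconditional bound. -/
theorem measureReal_le_of_forall_prefix {Ω S : Type*} [MeasurableSpace Ω] [Finite S]
    [MeasurableSpace S] [MeasurableSingletonClass S] {P : Measure Ω} [IsProbabilityMeasure P]
    {U : ℕ → Ω → S} (hU : ∀ n, Measurable (U n)) (n : ℕ) {A : Set Ω} {r : ℝ}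
    (h : ∀ s : ℕ → S, P.real (A ∩ {ω | ∀ m ≤ n, U m ω = s m})
      ≤ r * P.real {ω | ∀ m ≤ n, U m ω = s m}) : P.real A ≤ r := by
  have := Fintype.ofFinite S
  classical
  set E : (Fin (n + 1) → S) → Set Ω := fun s => {ω | ∀ m ≤ n, U m ω = s ⟨min m n, by omega⟩}
    with hE
  have hEm : ∀ s, MeasurableSet (E s) := fun s => by
    simp only [hE, Set.ofPred_forall]
    exact MeasurableSet.iInter fun m => MeasurableSet.iInter fun _ =>
      hU m (measurableSet_singleton _)
  have hcov : ∀ ω, ω ∈ E (fun m => U m ω) := fun ω m hm => by simp [min_eq_left hm]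
  have hA : P.real A ≤ ∑ s, P.real (A ∩ E s) := by
    refine (measureReal_mono (fun ω hω => ?_)).trans (measureReal_iUnion_fintype_le _)
    exact Set.mem_iUnion.2 ⟨fun m => U m ω, hω, hcov ω⟩
  have hsum : ∑ s, P.real (E s) = 1 := by
    rw [← measureReal_iUnion_fintype _ hEm, Set.iUnion_eq_univ_iff.2 fun ω => ⟨_, hcov ω⟩,
      probReal_univ]
    intro s s' hs
    refine Set.disjoint_left.2 fun ω h1 h2 => hs (funext fun m => ?_)
    have hm : (⟨min (m : ℕ) n, by omega⟩ : Fin (n + 1)) = m := Fin.ext (by simp; omega)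
    have := (h1 m (by omega)).symm.trans (h2 m (by omega))
    rwa [hm] at this
  calc P.real A ≤ ∑ s, P.real (A ∩ E s) := hA
    _ ≤ ∑ s, r * P.real (E s) :=
        Finset.sum_le_sum fun s _ => h fun m => s ⟨min m n, by omega⟩
    _ = r := by rw [← Finset.mul_sum, hsum, mul_one]

namespace IsJumpChain

variable {k : ℕ} {c : Fin k → Fin k → ℝ} {i : Fin k} {Ω : Type*} [MeasurableSpace Ω]
  {P : Measure Ω} {U : ℕ → Ω → Fin k} {H : ℕ → Ω → ℝ}

theorem measurableSet_history (h : IsJumpChain c i P U H) (n : ℕ) (s : ℕ → Fin k) (t : ℕ → ℝ) :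
    MeasurableSet {ω | ∀ m ≤ n, U m ω = s m ∧ t m < H m ω} := by
  simp only [Set.ofPred_forall]
  exact MeasurableSet.iInter fun m => MeasurableSet.iInter fun _ =>
    (h.measurable_state m (measurableSet_singleton _)).inter
      (measurableSet_lt measurable_const (h.measurable_holding m))

theorem measurableSet_window (h : IsJumpChain c i P U H) (n : ℕ) (s : ℕ → Fin k) (t b : ℕ → ℝ)
    (F : Finset ℕ) :
    MeasurableSet {ω | (∀ m ≤ n, U m ω = s m ∧ t m < H m ω) ∧ ∀ m ∈ F, H m ω ≤ b m} := by
  have hF : MeasurableSet {ω | ∀ m ∈ F, H m ω ≤ b m} := by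
    simp only [Set.ofPred_forall]
    exact MeasurableSet.iInter fun m => MeasurableSet.iInter fun _ =>
      measurableSet_le (h.measurable_holding m) measurable_const
  exact (h.measurableSet_history n s t).inter hF

/-- The law of the holding times, with some of them also bounded from above. -/
theorem law_window [IsProbabilityMeasure P] (h : IsJumpChain c i P U H) (n : ℕ) (s : ℕ → Fin k)
    (t b : ℕ → ℝ) (ht : ∀ m, 0 ≤ t m) (hb : ∀ m, t m ≤ b m) (F : Finset ℕ)
    (hF : F ⊆ Finset.range (n + 1)) :
    P.real {ω | (∀ m ≤ n, U m ω = s m ∧ t m < H m ω) ∧ ∀ m ∈ F, H m ω ≤ b m}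
      = pathWeight c i s n * ∏ m ∈ Finset.range (n + 1),
        (Real.exp (-exitRate c (s m) * t m)
          - if m ∈ F then Real.exp (-exitRate c (s m) * b m) else 0) := by
  -- Imposing `H l ≤ b l` means removing the event on which the lower bound `t l` is raised to `b
  -- l`. Hence the induction has to range over all `t`.
  induction F using Finset.induction_on generalizing t with
  | empty => simpa using h.law n s t ht
  | insert l F hl ih =>
    have hln : l ∈ Finset.range (n + 1) := hF (Finset.mem_insert_self l F)
    have hF' : F ⊆ Finset.range (n + 1) := (Finset.subset_insert l F).trans hF
    have hln' : l ≤ n := by simpa [Nat.lt_succ_iff] using hln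
    have e1 : {ω | (∀ m ≤ n, U m ω = s m ∧ t m < H m ω) ∧ ∀ m ∈ insert l F, H m ω ≤ b m}
        = {ω | (∀ m ≤ n, U m ω = s m ∧ t m < H m ω) ∧ ∀ m ∈ F, H m ω ≤ b m}
          \ {ω | (∀ m ≤ n, U m ω = s m ∧ Function.update t l (b l) m < H m ω)
              ∧ ∀ m ∈ F, H m ω ≤ b m} := by
      ext ω
      simp only [Set.mem_ofPred_eq, Set.mem_sdiff, Finset.mem_insert, forall_eq_or_imp]
      constructor
      · rintro ⟨h1, h2, h3⟩
        refine ⟨⟨h1, h3⟩, fun h4 => ?_⟩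
        have := (h4.1 l hln').2
        rw [Function.update_self] at this
        linarith
      · rintro ⟨⟨h1, h3⟩, h4⟩
        refine ⟨h1, ?_, h3⟩
        by_contra! h5
        refine h4 ⟨fun m hm => ⟨(h1 m hm).1, ?_⟩, h3⟩
        rcases eq_or_ne m l with rfl | hml
        · rwa [Function.update_self]
        · rw [Function.update_of_ne hml]
          exact (h1 m hm).2
    have hsub : {ω | (∀ m ≤ n, U m ω = s m ∧ Function.update t l (b l) m < H m ω)
              ∧ ∀ m ∈ F, H m ω ≤ b m}
        ⊆ {ω | (∀ m ≤ n, U m ω = s m ∧ t m < H m ω) ∧ ∀ m ∈ F, H m ω ≤ b m} := by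
      rintro ω ⟨h1, h2⟩
      refine ⟨fun m hm => ⟨(h1 m hm).1, ?_⟩, h2⟩
      have := (h1 m hm).2
      rcases eq_or_ne m l with rfl | hml
      · rw [Function.update_self] at this
        exact (hb m).trans_lt this
      · rwa [Function.update_of_ne hml] at this
    rw [e1, measureReal_sdiff hsub (h.measurableSet_window n s _ b F), ih t ht hb hF',
      ih (Function.update t l (b l)) (fun m => ?_) (fun m => ?_) hF',
      ← Finset.mul_prod_erase _ _ hln, ← Finset.mul_prod_erase _ _ hln,
      ← Finset.mul_prod_erase _ _ hln]
    · have e2 : ∀ m ∈ (Finset.range (n + 1)).erase l,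
          (Real.exp (-exitRate c (s m) * Function.update t l (b l) m)
            - if m ∈ F then Real.exp (-exitRate c (s m) * b m) else 0)
          = (Real.exp (-exitRate c (s m) * t m)
            - if m ∈ F then Real.exp (-exitRate c (s m) * b m) else 0) := fun m hm => by
        rw [Function.update_of_ne (Finset.ne_of_mem_erase hm)]
      have e3 : ∀ m ∈ (Finset.range (n + 1)).erase l,
          (Real.exp (-exitRate c (s m) * t m)
            - if m ∈ insert l F then Real.exp (-exitRate c (s m) * b m) else 0)
          = (Real.exp (-exitRate c (s m) * t m)
            - if m ∈ F then Real.exp (-exitRate c (s m) * b m) else 0) := fun m hm => by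
        simp [Finset.ne_of_mem_erase hm]
      rw [Finset.prod_congr rfl e2, Finset.prod_congr rfl e3]
      simp [hl]
      ring
    · rcases eq_or_ne m l with rfl | hml
      · rw [Function.update_self]
        exact (ht m).trans (hb m)
      · rw [Function.update_of_ne hml]
        exact ht m
    · rcases eq_or_ne m l with rfl | hml
      · rw [Function.update_self]
      · rw [Function.update_of_ne hml]
        exact hb m

theorem law_zero (h : IsJumpChain c i P U H) (n : ℕ) (s : ℕ → Fin k) :
    P.real {ω | ∀ m ≤ n, U m ω = s m ∧ 0 < H m ω} = pathWeight c i s n := by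
  simpa using h.law n s (fun _ => 0) fun _ => le_rfl

/-- All holding times are positive. -/
theorem ae_holding_pos [IsProbabilityMeasure P] (h : IsJumpChain c i P U H)
    (hpos : ∀ j, 0 < exitRate c j) : ∀ᵐ ω ∂P, ∀ m, 0 < H m ω := by
  have key : ∀ n, ∀ᵐ ω ∂P, ∀ m ≤ n, 0 < H m ω := by
    intro n
    induction n with
    | zero =>
      have h1 := h.law_zero 0 fun _ => i
      have h2 := h.measurableSet_history 0 (fun _ => i) fun _ => 0
      rw [pathWeight] at h1
      simp only [if_true, Finset.range_zero, Finset.prod_empty, mul_one] at h1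
      rw [measureReal_def, ENNReal.toReal_eq_one_iff, ← mem_ae_iff_prob_eq_one h2] at h1
      filter_upwards [h1] with ω hω m hm
      exact (hω m hm).2
    | succ n ih =>
      -- The law only describes events on which the holding times are positive, so positivity comes
      -- from counting mass. The events `B v` extend `A` by a next state `v` with positive holding
      -- time. As `∑ v, c (s n) v / exitRate c (s n) = 1`, they exhaust `A` up to a null set.
      refine ae_of_forall_prefix U n fun s => ?_
      set A := {ω | ∀ m ≤ n, U m ω = s m ∧ 0 < H m ω}
      set B : Fin k → Set Ω := fun v =>
        {ω | ∀ m ≤ n + 1, U m ω = Function.update s (n + 1) v m ∧ 0 < H m ω} with hB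
      have hBm : ∀ v, MeasurableSet (B v) := fun v => h.measurableSet_history _ _ _
      have hBA : ⋃ v, B v ⊆ A := by
        refine Set.iUnion_subset fun v ω hω m hm => ?_
        have := hω m (by omega)
        rwa [Function.update_of_ne (by omega)] at this
      have hBd : Pairwise (Function.onFun Disjoint B) := fun v w hvw =>
        Set.disjoint_left.2 fun ω h1 h2 => hvw (by
          have := (h1 (n + 1) le_rfl).1.symm.trans (h2 (n + 1) le_rfl).1
          simpa using this)
      have hB1 : ∀ v, P.real (B v) = P.real A * (c (s n) v / exitRate c (s n)) := fun v => by
        rw [h.law_zero, h.law_zero, pathWeight_succ,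
          pathWeight_congr (s' := s) c i fun m hm => Function.update_of_ne (by omega) _ _]
        simp
      have hsum : P.real (⋃ v, B v) = P.real A := by
        rw [measureReal_iUnion_fintype hBd hBm, Finset.sum_congr rfl fun v _ => hB1 v,
          ← Finset.mul_sum, ← Finset.sum_div]
        have := (hpos (s n)).ne'
        rw [← exitRate, div_self this, mul_one]
      have h0 : P.real (A \ ⋃ v, B v) = 0 := by
        rw [measureReal_sdiff hBA (MeasurableSet.iUnion hBm), hsum, sub_self]
      rw [measureReal_eq_zero_iff, measure_eq_zero_iff_ae_notMem] at h0
      filter_upwards [h0, ih] with ω h1 h2 h3 m hm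
      rcases Nat.lt_or_ge n m with h4 | h4
      · have h5 : ω ∈ ⋃ v, B v := by
          by_contra h5
          exact h1 ⟨fun m hm => ⟨h3 m hm, h2 m hm⟩, h5⟩
        obtain ⟨v, hv⟩ := Set.mem_iUnion.1 h5
        exact (hv m hm).2
      · exact h2 m h4
  exact (ae_all_iff.2 key).mono fun ω hω m => hω m m le_rfl

/-- Holding times are almost surely positive, so the condition `0 < H m` can be dropped from the law
at `t = 0`. -/
theorem measureReal_prefix [IsProbabilityMeasure P] (h : IsJumpChain c i P U H)
    (hpos : ∀ j, 0 < exitRate c j) (n : ℕ) (s : ℕ → Fin k) :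
    P.real {ω | ∀ m ≤ n, U m ω = s m} = pathWeight c i s n := by
  rw [← h.law_zero]
  refine measureReal_congr ?_
  filter_upwards [h.ae_holding_pos hpos] with ω hω
  exact propext ⟨fun h m hm => ⟨h m hm, hω m⟩, fun h m hm => (h m hm).1⟩

/-- Consecutive states differ. -/
theorem ae_state_succ_ne [IsProbabilityMeasure P] (h : IsJumpChain c i P U H)
    (hpos : ∀ j, 0 < exitRate c j) (hdiag : ∀ j, c j j = 0) :
    ∀ᵐ ω ∂P, ∀ m, U (m + 1) ω ≠ U m ω := by
  refine ae_all_iff.2 fun m => ae_of_forall_prefix U (m + 1) fun s => ?_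
  rcases eq_or_ne (s (m + 1)) (s m) with hs | hs
  · have h1 := h.measureReal_prefix hpos (m + 1) s
    rw [pathWeight_succ, hs, hdiag, zero_div, mul_zero, measureReal_eq_zero_iff,
      measure_eq_zero_iff_ae_notMem] at h1
    filter_upwards [h1] with ω h1 h2
    exact absurd h2 h1
  · refine Eventually.of_forall fun ω hω => ?_
    rwa [hω (m + 1) le_rfl, hω m (Nat.le_succ m)]

/-- Infinitely many holding times exceed `1`. -/
theorem ae_exists_one_lt_holding [IsProbabilityMeasure P] (h : IsJumpChain c i P U H)
    (hpos : ∀ j, 0 < exitRate c j) (l : ℕ) : ∀ᵐ ω ∂P, ∃ m ≥ l, 1 < H m ω := by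
  -- A bound, uniform in the state, on the probability that a holding time is at most `1`; the sum
  -- of the rates serves as a crude bound for each of them.
  set ρ : ℝ := 1 - Real.exp (-∑ j, exitRate c j) with hρ
  have hρ1 : ρ < 1 := by have := Real.exp_pos (-∑ j, exitRate c j); linarith
  have hρ0 : 0 ≤ ρ := by
    have : Real.exp (-∑ j, exitRate c j) ≤ 1 :=
      Real.exp_le_one_iff.2 (neg_nonpos.2 (Finset.sum_nonneg fun j _ => (hpos j).le))
    linarith
  have hexp : ∀ j, 1 - Real.exp (-exitRate c j) ≤ ρ := fun j => by
    have : exitRate c j ≤ ∑ j, exitRate c j :=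
      Finset.single_le_sum (f := exitRate c) (fun j _ => (hpos j).le) (Finset.mem_univ j)
    have := Real.exp_le_exp.2 (neg_le_neg this)
    linarith
  set A : Set Ω := {ω | ∀ m ≥ l, H m ω ≤ 1}
  have hA : ∀ n : ℕ, P.real A ≤ ρ ^ (n + 1) := by
    intro n
    refine measureReal_le_of_forall_prefix h.measurable_state (l + n) fun s => ?_
    -- Given the states, each of the `n + 1` holding times with index in `F` contributes a factor at
    -- most `ρ`, and the others a factor `1`.
    set F := Finset.Icc l (l + n) with hFdef
    have hF : F ⊆ Finset.range (l + n + 1) := fun m hm => by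
      rw [hFdef, Finset.mem_Icc] at hm
      exact Finset.mem_range.2 (by omega)
    have h1 := h.law_window (l + n) s (fun _ => 0) (fun _ => 1) (fun _ => le_rfl)
      (fun _ => zero_le_one) F hF
    rw [h.measureReal_prefix hpos]
    calc P.real (A ∩ {ω | ∀ m ≤ l + n, U m ω = s m})
        ≤ P.real {ω | (∀ m ≤ l + n, U m ω = s m ∧ 0 < H m ω) ∧ ∀ m ∈ F, H m ω ≤ 1} := by
          refine ENNReal.toReal_mono (measure_ne_top _ _) (measure_mono_ae ?_)
          filter_upwards [h.ae_holding_pos hpos] with ω hω hωA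
          exact ⟨fun m hm => ⟨hωA.2 m hm, hω m⟩, fun m hm => hωA.1 m (Finset.mem_Icc.1 hm).1⟩
      _ ≤ ρ ^ (n + 1) * pathWeight c i s (l + n) := by
          rw [h1, mul_comm]
          refine mul_le_mul_of_nonneg_right ?_
            (by rw [← h.measureReal_prefix hpos]; exact measureReal_nonneg)
          calc _ ≤ ∏ m ∈ Finset.range (l + n + 1), (if m ∈ F then ρ else 1) := by
                refine Finset.prod_le_prod (fun m _ => ?_) fun m _ => ?_
                · split_ifs
                  · simpa using (hpos (s m)).le
                  · simp
                · split_ifs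
                  · simpa using hexp (s m)
                  · simp
            _ = ρ ^ (n + 1) := by
                rw [Finset.prod_ite_mem, Finset.inter_eq_right.2 hF, Finset.prod_const,
                  hFdef, Nat.card_Icc]
                congr 1
                omega
  have hA0 : P.real A = 0 := by
    refine le_antisymm (ge_of_tendsto' ((tendsto_pow_atTop_nhds_zero_of_lt_one hρ0 hρ1).comp
      (tendsto_add_atTop_nat 1)) hA) measureReal_nonneg
  rw [measureReal_eq_zero_iff, measure_eq_zero_iff_ae_notMem] at hA0
  filter_upwards [hA0] with ω hω
  by_contra! h1
  exact hω h1

/-- The chain does not explode. -/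
theorem ae_tendsto_sum_holding [IsProbabilityMeasure P] (h : IsJumpChain c i P U H)
    (hpos : ∀ j, 0 < exitRate c j) :
    ∀ᵐ ω ∂P, Tendsto (fun n => ∑ m ∈ Finset.range n, H m ω) atTop atTop := by
  filter_upwards [h.ae_holding_pos hpos, ae_all_iff.2 (h.ae_exists_one_lt_holding hpos)]
    with ω h1 h2
  rw [← not_summable_iff_tendsto_nat_atTop_of_nonneg fun m => (h1 m).le]
  intro h3
  obtain ⟨l, hl⟩ := eventually_atTop.1 (h3.tendsto_atTop_zero.eventually_lt_const one_pos)
  obtain ⟨m, hm, hm1⟩ := h2 l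
  exact (hl m hm).not_gt hm1

end IsJumpChain

/-! ### Rounding the holding times: the coupled discrete-time chain. -/

/-- Position at the integer time `n` of a process that spends the time `N m` in its `m`-th
holding interval: the index of the current interval and the time already spent there. -/
def position (N : ℕ → ℕ) : ℕ → ℕ × ℕ
  | 0 => (0, 0)
  | n + 1 =>
    if (position N n).2 + 1 < N (position N n).1 then
      ((position N n).1, (position N n).2 + 1)
    else ((position N n).1 + 1, 0)

/-- One time step either lengthens the stay in the current interval or completes that interval.
Positivity of `N` ensures that the time spent, `0`, is admissible in a newly entered interval. -/
theorem position_spec {N : ℕ → ℕ} (hN : ∀ m, 0 < N m) (n : ℕ) :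
    (position N n).2 < N (position N n).1 ∧
      ∑ m ∈ Finset.range (position N n).1, N m + (position N n).2 = n := by
  induction n with
  | zero => simp [position, hN]
  | succ n ih =>
    rw [position]
    split_ifs with h
    · exact ⟨h, by simp only; omega⟩
    · refine ⟨hN _, ?_⟩
      simp only [Finset.sum_range_succ]
      omega

theorem position_fst_eq {N : ℕ → ℕ} (hN : ∀ m, 0 < N m) {n j : ℕ}
    (h1 : ∑ m ∈ Finset.range j, N m ≤ n) (h2 : n < ∑ m ∈ Finset.range (j + 1), N m) :
    (position N n).1 = j := by
  obtain ⟨h3, h4⟩ := position_spec hN n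
  have hmono : Monotone fun j => ∑ m ∈ Finset.range j, N m := fun a b hab =>
    Finset.sum_le_sum_of_subset (Finset.range_mono hab)
  rcases lt_trichotomy (position N n).1 j with h | h | h
  · have := hmono (show (position N n).1 + 1 ≤ j from h)
    simp only [Finset.sum_range_succ] at this
    omega
  · exact h
  · have := hmono (show j + 1 ≤ (position N n).1 from h)
    simp only at this
    omega

/-- `-log (1 - q δ) / q`, where `q` is the exit rate: an exponential variable of rate `q` exceeds
`n` times this number with probability `(1 - q δ) ^ n`. -/
noncomputable def stepHolding {k : ℕ} (c : Fin k → Fin k → ℝ) (δ : ℝ) (j : Fin k) : ℝ :=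
  -Real.log (1 - exitRate c j * δ) / exitRate c j

theorem stepHolding_pos {k : ℕ} {c : Fin k → Fin k → ℝ} {δ : ℝ} {j : Fin k}
    (hpos : 0 < exitRate c j) (hδ : 0 < δ) (hδ1 : exitRate c j * δ < 1) :
    0 < stepHolding c δ j := by
  have : 0 < exitRate c j * δ := mul_pos hpos hδ
  exact div_pos (neg_pos.2 (Real.log_neg (by linarith) (by linarith))) hpos

theorem exp_neg_mul_stepHolding {k : ℕ} {c : Fin k → Fin k → ℝ} {δ : ℝ} {j : Fin k}
    (hpos : 0 < exitRate c j) (hδ1 : exitRate c j * δ < 1) (n : ℕ) :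
    Real.exp (-exitRate c j * (n * stepHolding c δ j)) = (1 - exitRate c j * δ) ^ n := by
  have h1 : -exitRate c j * (n * stepHolding c δ j)
      = n * Real.log (1 - exitRate c j * δ) := by
    rw [stepHolding]
    field_simp
  rw [h1, Real.exp_nat_mul, Real.exp_log (by linarith)]

/-- The holding times, rounded up to integer multiples of time steps. -/
noncomputable def holdingSteps {k : ℕ} (c : Fin k → Fin k → ℝ) (δ : ℝ) {Ω : Type*}
    (U : ℕ → Ω → Fin k) (H : ℕ → Ω → ℝ) (ω : Ω) (m : ℕ) : ℕ :=
  ⌈H m ω / stepHolding c δ (U m ω)⌉₊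

/-- The discrete-time chain obtained from a jump chain by rounding its holding times. -/
noncomputable def discretizedChain {k : ℕ} (c : Fin k → Fin k → ℝ) (δ : ℝ) {Ω : Type*}
    (U : ℕ → Ω → Fin k) (H : ℕ → Ω → ℝ) (n : ℕ) (ω : Ω) : Fin k :=
  U (position (holdingSteps c δ U H ω) n).1 ω

theorem measurable_eval_nat {Ω β : Type*} [MeasurableSpace Ω] [MeasurableSpace β]
    {f : ℕ → Ω → β} (hf : ∀ n, Measurable (f n)) {J : Ω → ℕ} (hJ : Measurable J) :
    Measurable fun ω => f (J ω) ω := by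
  have : Measurable fun p : ℕ × Ω => f p.1 p.2 := measurable_from_prod_countable_right hf
  exact this.comp (hJ.prodMk measurable_id)

theorem measurable_position {Ω : Type*} [MeasurableSpace Ω] {N : Ω → ℕ → ℕ}
    (hN : ∀ m, Measurable fun ω => N ω m) (n : ℕ) : Measurable fun ω => position (N ω) n := by
  induction n with
  | zero => exact measurable_const
  | succ n ih =>
    simp only [position]
    refine Measurable.ite (measurableSet_lt (ih.snd.add_const 1) ?_) ?_ ?_
    · exact measurable_eval_nat (f := fun m ω => N ω m) hN ih.fst
    · exact ih.fst.prodMk (ih.snd.add_const 1)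
    · exact (ih.fst.add_const 1).prodMk measurable_const

/-- The event that the first states are `σ 0, …, σ j`, with rounded holding times `a m + 1` for
`m < j` and more than `a j` for `m = j`. -/
def History {k : ℕ} {Ω : Type*} (U : ℕ → Ω → Fin k) (N : Ω → ℕ → ℕ) (j : ℕ)
    (σ : ℕ → Fin k) (a : ℕ → ℕ) (ω : Ω) : Prop :=
  (∀ m ≤ j, U m ω = σ m ∧ a m < N ω m) ∧ ∀ m ∈ Finset.range j, N ω m ≤ a m + 1

/-- The event that the chain stays for one more step: only the lower bound on the current rounded
holding time changes. -/
theorem history_stay_iff {k : ℕ} {Ω : Type*} {U : ℕ → Ω → Fin k} {N : Ω → ℕ → ℕ} {j : ℕ}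
    {σ : ℕ → Fin k} {a : ℕ → ℕ} {ω : Ω} :
    History U N j σ (Function.update a j (a j + 1)) ω
      ↔ History U N j σ a ω ∧ a j + 1 < N ω j := by
  constructor
  · rintro ⟨h1, h2⟩
    have h3 := (h1 j le_rfl).2
    rw [Function.update_self] at h3
    refine ⟨⟨fun m hm => ⟨(h1 m hm).1, ?_⟩, fun m hm => ?_⟩, h3⟩
    · rcases eq_or_ne m j with rfl | hmj
      · omega
      · simpa [Function.update_of_ne hmj] using (h1 m hm).2
    · have := h2 m hm
      rwa [Function.update_of_ne (by have := Finset.mem_range.1 hm; omega)] at this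
  · rintro ⟨⟨h1, h2⟩, h3⟩
    refine ⟨fun m hm => ⟨(h1 m hm).1, ?_⟩, fun m hm => ?_⟩
    · rcases eq_or_ne m j with rfl | hmj
      · simpa using h3
      · simpa [Function.update_of_ne hmj] using (h1 m hm).2
    · rw [Function.update_of_ne (by have := Finset.mem_range.1 hm; omega)]
      exact h2 m hm

/-- The event that the chain jumps to `v`: the bounds on `N ω j` close up to `N ω j = a j + 1`, and
a new interval opens with the bound `0 < N ω (j + 1)`. -/
theorem history_jump_iff {k : ℕ} {Ω : Type*} {U : ℕ → Ω → Fin k} {N : Ω → ℕ → ℕ} {j : ℕ}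
    {σ : ℕ → Fin k} {a : ℕ → ℕ} {v : Fin k} {ω : Ω} :
    History U N (j + 1) (Function.update σ (j + 1) v) (Function.update a (j + 1) 0) ω
      ↔ History U N j σ a ω ∧ N ω j ≤ a j + 1 ∧ U (j + 1) ω = v ∧ 0 < N ω (j + 1) := by
  constructor
  · rintro ⟨h1, h2⟩
    have h3 := h1 (j + 1) le_rfl
    have h4 := h2 j (Finset.self_mem_range_succ j)
    rw [Function.update_self, Function.update_self] at h3
    rw [Function.update_of_ne (by omega)] at h4
    refine ⟨⟨fun m hm => ?_, fun m hm => ?_⟩, h4, h3⟩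
    · have := h1 m (by omega)
      rwa [Function.update_of_ne (by omega), Function.update_of_ne (by omega)] at this
    · have hm := Finset.mem_range.1 hm
      have := h2 m (Finset.mem_range.2 (by omega))
      rwa [Function.update_of_ne (by omega)] at this
  · rintro ⟨⟨h1, h2⟩, h3, h4⟩
    refine ⟨fun m hm => ?_, fun m hm => ?_⟩
    · rcases Nat.lt_or_ge j m with hmj | hmj
      · obtain rfl : m = j + 1 := by omega
        rwa [Function.update_self, Function.update_self]
      · rw [Function.update_of_ne (by omega), Function.update_of_ne (by omega)]
        exact h1 m hmj
    · have hm := Finset.mem_range.1 hm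
      rw [Function.update_of_ne (by omega)]
      rcases Nat.lt_or_ge m j with hmj | hmj
      · exact h2 m (Finset.mem_range.2 hmj)
      · obtain rfl : m = j := by omega
        exact h3

/-- The probability of `History U N j σ a` for the rounded holding times `N`. -/
noncomputable def historyWeight {k : ℕ} (c : Fin k → Fin k → ℝ) (i : Fin k) (δ : ℝ) (j : ℕ)
    (σ : ℕ → Fin k) (a : ℕ → ℕ) : ℝ :=
  pathWeight c i σ j * ((∏ m ∈ Finset.range j,
    (1 - exitRate c (σ m) * δ) ^ a m * (exitRate c (σ m) * δ))
      * (1 - exitRate c (σ j) * δ) ^ a j)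

theorem historyWeight_stay {k : ℕ} (c : Fin k → Fin k → ℝ) (i : Fin k) (δ : ℝ) (j : ℕ)
    (σ : ℕ → Fin k) (a : ℕ → ℕ) :
    historyWeight c i δ j σ (Function.update a j (a j + 1))
      = historyWeight c i δ j σ a * (1 - exitRate c (σ j) * δ) := by
  rw [historyWeight, historyWeight, Function.update_self, Finset.prod_congr rfl fun m hm => by
    rw [Function.update_of_ne (by have := Finset.mem_range.1 hm; omega)], pow_succ]
  ring

/-- The factor `exitRate c (σ j) * δ` for ending the stay cancels the denominator of the jump
probability and leaves the off-diagonal entry `c (σ j) v * δ`. -/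
theorem historyWeight_jump {k : ℕ} {c : Fin k → Fin k → ℝ} (i : Fin k) (δ : ℝ) (j : ℕ)
    (σ : ℕ → Fin k) (a : ℕ → ℕ) (v : Fin k) (hpos : 0 < exitRate c (σ j)) :
    historyWeight c i δ (j + 1) (Function.update σ (j + 1) v) (Function.update a (j + 1) 0)
      = historyWeight c i δ j σ a * (c (σ j) v * δ) := by
  have h1 : ∏ m ∈ Finset.range (j + 1),
      (1 - exitRate c (Function.update σ (j + 1) v m) * δ) ^ Function.update a (j + 1) 0 m
        * (exitRate c (Function.update σ (j + 1) v m) * δ)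
      = ∏ m ∈ Finset.range (j + 1),
        (1 - exitRate c (σ m) * δ) ^ a m * (exitRate c (σ m) * δ) :=
    Finset.prod_congr rfl fun m hm => by
      have := Finset.mem_range.1 hm
      rw [Function.update_of_ne (by omega), Function.update_of_ne (by omega)]
  rw [historyWeight, historyWeight, h1, pathWeight_succ,
    pathWeight_congr (s' := σ) c i fun m hm => Function.update_of_ne (by omega) _ _,
    Function.update_self, Function.update_self, Function.update_of_ne (by omega),
    Finset.prod_range_succ, pow_zero]
  generalize (∏ m ∈ Finset.range j,
    (1 - exitRate c (σ m) * δ) ^ a m * (exitRate c (σ m) * δ)) = p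
  field_simp

namespace IsJumpChain

variable {k : ℕ} {c : Fin k → Fin k → ℝ} {i : Fin k} {Ω : Type*} [MeasurableSpace Ω]
  {P : Measure Ω} {U : ℕ → Ω → Fin k} {H : ℕ → Ω → ℝ}

theorem measurable_holdingSteps (h : IsJumpChain c i P U H) (δ : ℝ) (m : ℕ) :
    Measurable fun ω => holdingSteps c δ U H ω m :=
  Nat.measurable_ceil.comp ((h.measurable_holding m).div
    ((measurable_of_finite (stepHolding c δ)).comp (h.measurable_state m)))

theorem measurable_discretizedChain (h : IsJumpChain c i P U H) (δ : ℝ) (n : ℕ) :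
    Measurable (discretizedChain c δ U H n) :=
  measurable_eval_nat h.measurable_state
    (measurable_position (h.measurable_holdingSteps δ) n).fst

theorem ae_holdingSteps_pos [IsProbabilityMeasure P] (h : IsJumpChain c i P U H)
    (hpos : ∀ j, 0 < exitRate c j) {δ : ℝ} (hδ : 0 < δ) (hδ1 : ∀ j, exitRate c j * δ < 1) :
    ∀ᵐ ω ∂P, ∀ m, 0 < holdingSteps c δ U H ω m := by
  filter_upwards [h.ae_holding_pos hpos] with ω hω m
  exact Nat.ceil_pos.2 (div_pos (hω m) (stepHolding_pos (hpos _) hδ (hδ1 _)))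

/-- A rounded holding time equals `a + 1` when `H` lies between `a` and `a + 1` rounding units. By
the choice of the unit this has probability `(1 - q δ) ^ a - (1 - q δ) ^ (a + 1) = (1 - q δ) ^ a *
(q δ)`. -/
theorem measureReal_history [IsProbabilityMeasure P] (h : IsJumpChain c i P U H)
    (hpos : ∀ j, 0 < exitRate c j) {δ : ℝ} (hδ : 0 < δ) (hδ1 : ∀ j, exitRate c j * δ < 1)
    (j : ℕ) (σ : ℕ → Fin k) (a : ℕ → ℕ) :
    P.real {ω | History U (holdingSteps c δ U H) j σ a ω} = historyWeight c i δ j σ a := by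
  have hh : ∀ v, 0 < stepHolding c δ v := fun v => stepHolding_pos (hpos v) hδ (hδ1 v)
  have h1 := h.law_window j σ (fun m => a m * stepHolding c δ (σ m))
    (fun m => (a m + 1 : ℕ) * stepHolding c δ (σ m))
    (fun m => mul_nonneg (Nat.cast_nonneg _) (hh _).le)
    (fun m => mul_le_mul_of_nonneg_right (by push_cast; linarith) (hh _).le)
    (Finset.range j) (Finset.range_mono (Nat.le_succ j))
  have h2 : {ω | History U (holdingSteps c δ U H) j σ a ω}
      = {ω | (∀ m ≤ j, U m ω = σ m ∧ a m * stepHolding c δ (σ m) < H m ω) ∧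
          ∀ m ∈ Finset.range j, H m ω ≤ (a m + 1 : ℕ) * stepHolding c δ (σ m)} := by
    ext ω
    have hlt : ∀ m v, a m < ⌈H m ω / stepHolding c δ v⌉₊ ↔ a m * stepHolding c δ v < H m ω :=
      fun m v => by rw [Nat.lt_ceil, lt_div_iff₀ (hh v)]
    have hle : ∀ m v, ⌈H m ω / stepHolding c δ v⌉₊ ≤ a m + 1
        ↔ H m ω ≤ (a m + 1 : ℕ) * stepHolding c δ v :=
      fun m v => by rw [Nat.ceil_le, div_le_iff₀ (hh v)]
    simp only [Set.mem_ofPred_eq, History, holdingSteps, hlt, hle]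
    constructor
    · rintro ⟨h3, h4⟩
      refine ⟨fun m hm => ?_, fun m hm => ?_⟩
      · rw [← (h3 m hm).1]
        exact ⟨rfl, (h3 m hm).2⟩
      · rw [← (h3 m (Finset.mem_range.1 hm).le).1]
        exact h4 m hm
    · rintro ⟨h3, h4⟩
      refine ⟨fun m hm => ?_, fun m hm => ?_⟩
      · rw [(h3 m hm).1]
        exact ⟨rfl, (h3 m hm).2⟩
      · rw [(h3 m (Finset.mem_range.1 hm).le).1]
        exact h4 m hm
  rw [h2, h1, historyWeight, Finset.prod_range_succ, if_neg (by simp), sub_zero,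
    exp_neg_mul_stepHolding (hpos _) (hδ1 _)]
  congr 2
  refine Finset.prod_congr rfl fun m hm => ?_
  rw [if_pos hm, exp_neg_mul_stepHolding (hpos _) (hδ1 _),
    exp_neg_mul_stepHolding (hpos _) (hδ1 _)]
  ring

/-- Up to a null set, each prefix of the discretized chain is a `History`, and it has the
probability that it has for the Markov chain with transition probabilities
`transitionMatrix c δ`. -/
theorem exists_history [IsProbabilityMeasure P] (h : IsJumpChain c i P U H)
    (hpos : ∀ j, 0 < exitRate c j) (hdiag : ∀ j, c j j = 0) {δ : ℝ} (hδ : 0 < δ)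
    (hδ1 : ∀ j, exitRate c j * δ < 1) (n : ℕ) (s : ℕ → Fin k) :
    ∃ (j : ℕ) (σ : ℕ → Fin k) (a : ℕ → ℕ), σ j = s n ∧
      (∀ ω, History U (holdingSteps c δ U H) j σ a ω →
        position (holdingSteps c δ U H ω) n = (j, a j)) ∧
      (∀ᵐ ω ∂P, (∀ m ≤ n, discretizedChain c δ U H m ω = s m)
        ↔ History U (holdingSteps c δ U H) j σ a ω) ∧
      historyWeight c i δ j σ a = (if s 0 = i then 1 else 0)
        * ∏ m ∈ Finset.range n, transitionMatrix c δ (s m) (s (m + 1)) := by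
  induction n with
  | zero =>
    refine ⟨0, s, fun _ => 0, rfl, fun ω _ => rfl, ?_, by simp [historyWeight, pathWeight]⟩
    filter_upwards [h.ae_holdingSteps_pos hpos hδ hδ1] with ω hω
    simp [History, discretizedChain, position, hω]
  | succ n ih =>
    obtain ⟨j, σ, a, hσ, hp, hae, hw⟩ := ih
    have hsplit : ∀ ω, (∀ m ≤ n + 1, discretizedChain c δ U H m ω = s m)
        ↔ (∀ m ≤ n, discretizedChain c δ U H m ω = s m)
          ∧ discretizedChain c δ U H (n + 1) ω = s (n + 1) := fun ω => by
      simp only [Nat.le_succ_iff, or_imp, forall_and, forall_eq]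
    rw [Finset.prod_range_succ, ← mul_assoc, ← hw, ← hσ]
    rcases eq_or_ne (s (n + 1)) (s n) with hs | hs
    -- A repeated value means that the chain has stayed, since a jump almost surely changes the
    -- state.
    · refine ⟨j, σ, Function.update a j (a j + 1), hσ.trans hs.symm, fun ω hω => ?_, ?_, ?_⟩
      · rw [history_stay_iff] at hω
        rw [position, hp ω hω.1, Function.update_self, if_pos hω.2]
      · filter_upwards [hae, h.ae_state_succ_ne hpos hdiag] with ω h1 h2
        rw [hsplit, h1, history_stay_iff]
        refine and_congr_right fun h3 => ?_
        rw [discretizedChain, position, hp ω h3]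
        have h4 := (h3.1 j le_rfl).1
        split_ifs with h5
        · simp [h5, h4, hσ, hs]
        · simpa [h5, hs, ← hσ, ← h4] using h2 j
      · rw [historyWeight_stay, hs, ← hσ, transitionMatrix, if_pos rfl, exitRate]
    -- A new value forces a jump; the bound `0` for the new interval is almost surely automatic.
    · refine ⟨j + 1, Function.update σ (j + 1) (s (n + 1)), Function.update a (j + 1) 0,
        Function.update_self .., fun ω hω => ?_, ?_, ?_⟩
      · rw [history_jump_iff] at hω
        rw [position, hp ω hω.1, Function.update_self, if_neg (not_lt.2 hω.2.1)]
      · filter_upwards [hae, h.ae_holdingSteps_pos hpos hδ hδ1] with ω h1 h2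
        rw [hsplit, h1, history_jump_iff]
        refine and_congr_right fun h3 => ?_
        rw [discretizedChain, position, hp ω h3]
        have h4 := (h3.1 j le_rfl).1
        split_ifs with h5
        · simp only [h4, hσ, hs.symm, false_iff]
          exact fun h6 => absurd h5 (not_lt.2 h6.1)
        · simp [h2, not_lt.1 h5]
      · rw [historyWeight_jump _ _ _ _ _ _ (hpos _), transitionMatrix,
          if_neg (by rw [hσ]; exact hs.symm)]

/-- The discretized chain is Markov with transition probabilities `transitionMatrix c δ`. -/
theorem measureReal_discretizedChain [IsProbabilityMeasure P] (h : IsJumpChain c i P U H)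
    (hpos : ∀ j, 0 < exitRate c j) (hdiag : ∀ j, c j j = 0) {δ : ℝ} (hδ : 0 < δ)
    (hδ1 : ∀ j, exitRate c j * δ < 1) (n : ℕ) (s : ℕ → Fin k) :
    P.real {ω | ∀ m ≤ n, discretizedChain c δ U H m ω = s m}
      = (if s 0 = i then 1 else 0)
        * ∏ m ∈ Finset.range n, transitionMatrix c δ (s m) (s (m + 1)) := by
  obtain ⟨j, σ, a, -, -, hae, hw⟩ := h.exists_history hpos hdiag hδ hδ1 n s
  rw [← hw, ← h.measureReal_history hpos hδ hδ1]
  exact measureReal_congr (hae.mono fun ω hω => propext hω)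

end IsJumpChain

/-! ### Laws of finite-state sequences and of their rescaled walks. -/

/-- If two cylinders meet at `z`, both are cylinders around `z`, and their intersection is the
longer one. -/
theorem isPiSystem_cylinder (S : Type*) :
    IsPiSystem {A : Set (ℕ → S) | ∃ (x : ℕ → S) (n : ℕ), A = PiNat.cylinder x n} := by
  rintro _ ⟨x, n, rfl⟩ _ ⟨x', n', rfl⟩ ⟨z, hz, hz'⟩
  refine ⟨z, max n n', ?_⟩
  rw [← PiNat.mem_cylinder_iff_eq.1 hz, ← PiNat.mem_cylinder_iff_eq.1 hz']
  ext w
  simp only [Set.mem_inter_iff, PiNat.mem_cylinder_iff, lt_max_iff, or_imp, forall_and]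

/-- Two sequences of random variables with finitely many values have the same law if their
prefixes have the same probabilities. -/
theorem map_eq_of_forall_prefix {Ω Ω' S : Type*} [MeasurableSpace Ω] [MeasurableSpace Ω'] [Finite S]
    [TopologicalSpace S] [DiscreteTopology S] [MeasurableSpace S] [BorelSpace S]
    {P : Measure Ω} {P' : Measure Ω'} [IsProbabilityMeasure P] [IsProbabilityMeasure P']
    {V : ℕ → Ω → S} {V' : ℕ → Ω' → S}
    (hV : ∀ n, Measurable (V n)) (hV' : ∀ n, Measurable (V' n))
    (h : ∀ (n : ℕ) (s : ℕ → S),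
      P.real {ω | ∀ m ≤ n, V m ω = s m} = P'.real {ω | ∀ m ≤ n, V' m ω = s m}) :
    P.map (fun ω n => V n ω) = P'.map (fun ω n => V' n ω) := by
  have hm : Measurable fun ω n => V n ω := measurable_pi_iff.2 hV
  have hm' : Measurable fun ω n => V' n ω := measurable_pi_iff.2 hV'
  have := Measure.isProbabilityMeasure_map hm.aemeasurable (μ := P)
  have := Measure.isProbabilityMeasure_map hm'.aemeasurable (μ := P')
  refine ext_of_generate_finite _ ?_ (isPiSystem_cylinder S) ?_ (by simp)
  · rw [BorelSpace.measurable_eq (α := ℕ → S)]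
    exact (PiNat.isTopologicalBasis_cylinders fun _ => S).borel_eq_generateFrom
  · rintro _ ⟨s, n, rfl⟩
    have hc : MeasurableSet (PiNat.cylinder s n) :=
      (PiNat.isOpen_cylinder (fun _ => S) s n).measurableSet
    rw [Measure.map_apply hm hc, Measure.map_apply hm' hc]
    cases n with
    | zero => simp
    | succ n =>
      have h1 := h n s
      rw [measureReal_def, measureReal_def,
        ENNReal.toReal_eq_toReal_iff' (measure_ne_top _ _) (measure_ne_top _ _)] at h1
      simpa only [PiNat.cylinder, Set.preimage_ofPred_eq, Nat.lt_succ_iff] using h1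

/-- `linearInterp x u` is jointly continuous in `x` and `u`. -/
theorem continuous_uncurry_linearInterp :
    Continuous fun p : (ℕ → ℝ) × ℝ≥0 => linearInterp p.1 p.2 := by
  have h1 : ∀ n : ℕ, ContinuousOn (fun p : (ℕ → ℝ) × ℝ≥0 => linearInterp p.1 p.2)
      (Prod.snd ⁻¹' Set.Icc (n : ℝ≥0) (n + 1)) := by
    intro n
    have hc : Continuous (fun p : (ℕ → ℝ) × ℝ≥0 =>
        p.1 n + ((p.2 : ℝ) - n) * (p.1 (n + 1) - p.1 n)) := by fun_prop
    exact hc.continuousOn.congr fun p hp => linearInterp_eq p.1 n hp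
  have h2 : ∀ n : ℕ, ContinuousOn (fun p : (ℕ → ℝ) × ℝ≥0 => linearInterp p.1 p.2)
      (Prod.snd ⁻¹' Set.Icc (0 : ℝ≥0) (n + 1)) := by
    intro n
    induction n with
    | zero => simpa using h1 0
    | succ n ih =>
      have := ih.union_of_isClosed (h1 (n + 1)) (isClosed_Icc.preimage continuous_snd)
        (isClosed_Icc.preimage continuous_snd)
      push_cast at this ⊢
      rwa [← Set.preimage_union, Set.Icc_union_Icc_eq_Icc zero_le (by norm_cast; omega)] at this
  rw [continuous_iff_continuousAt]
  intro p
  refine (h2 ⌊p.2⌋₊).continuousAt (continuous_snd.continuousAt.preimage_mem_nhds ?_)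
  have : Set.Icc (0 : ℝ≥0) (⌊p.2⌋₊ + 1) = Set.Iic ((⌊p.2⌋₊ : ℝ≥0) + 1) := by
    ext v; simp
  rw [this]
  exact Iic_mem_nhds (Nat.lt_floor_add_one p.2)

/-- The rescaled walk depends measurably on the sequence of the indices of the states. -/
theorem measurable_rescaledWalk {k : ℕ} (y : Fin k → ℝ) (δ : ℝ) :
    Measurable (rescaledWalk δ fun n (v : ℕ → Fin k) => y (v n)) := by
  refine Continuous.measurable (ContinuousMap.continuous_of_continuous_uncurry _ ?_)
  refine continuous_uncurry_linearInterp.comp (f := fun p : (ℕ → Fin k) × ℝ≥0 =>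
    (fun n => δ * walk (fun n (v : ℕ → Fin k) => y (v n)) n p.1, p.2 / δ.toNNReal)) ?_
  refine (continuous_pi fun n => ?_).prodMk (continuous_snd.div_const _)
  refine continuous_const.mul (continuous_finsetSum _ fun m _ => ?_)
  exact continuous_of_discreteTopology.comp ((continuous_apply m).comp continuous_fst)

/-- Recovers the index of a state from its real value, so that laws can be compared on sequences in
the finite set `Fin k`. -/
theorem exists_measurable_leftInverse {k : ℕ} {y : Fin k → ℝ} (hy : Function.Injective y)
    (i : Fin k) : ∃ f : ℝ → Fin k, Measurable f ∧ ∀ j, f (y j) = j := by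
  have hemb : MeasurableEmbedding y :=
    ⟨hy, measurable_of_finite y, fun s _ => (s.toFinite.image y).measurableSet⟩
  obtain ⟨f, hf, h⟩ := hemb.exists_measurable_extend measurable_id fun _ => ⟨i⟩
  exact ⟨f, hf, congrFun h⟩

theorem IsMarkovChain.measureReal_prefix {k : ℕ} {y : Fin k → ℝ} (hy : Function.Injective y)
    {p : Fin k → Fin k → ℝ} {i : Fin k} {Ω : Type*} [MeasurableSpace Ω] {P : Measure Ω}
    [IsProbabilityMeasure P] {Y : ℕ → Ω → ℝ} (h : IsMarkovChain y p P Y)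
    (h0 : ∀ᵐ ω ∂P, Y 0 ω = y i) (n : ℕ) (s : ℕ → Fin k) :
    P.real {ω | ∀ m ≤ n, Y m ω = y (s m)}
      = (if s 0 = i then 1 else 0) * ∏ m ∈ Finset.range n, p (s m) (s (m + 1)) := by
  induction n with
  | zero =>
    have h1 : {ω | ∀ m ≤ 0, Y m ω = y (s m)} =ᵐ[P] {_ω | s 0 = i} := by
      filter_upwards [h0] with ω hω
      refine propext ?_
      simp [Set.ofPred, hω, hy.eq_iff, eq_comm]
    rw [measureReal_congr h1]
    split_ifs with h2 <;> simp [h2]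
  | succ n ih => rw [h.markov, ih, Finset.prod_range_succ, mul_assoc]

/-- The law of the rescaled walk is determined by the transition probabilities. -/
theorem identDistrib_rescaledWalk {k : ℕ} {y : Fin k → ℝ} (hy : Function.Injective y)
    {p : Fin k → Fin k → ℝ} {i : Fin k} {Ω Ω' : Type*} [MeasurableSpace Ω] [MeasurableSpace Ω']
    {P : Measure Ω} [IsProbabilityMeasure P] {P' : Measure Ω'} [IsProbabilityMeasure P']
    {Y : ℕ → Ω → ℝ} (h : IsMarkovChain y p P Y) (h0 : ∀ᵐ ω ∂P, Y 0 ω = y i)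
    {V : ℕ → Ω' → Fin k} (hV : ∀ n, Measurable (V n))
    (hVlaw : ∀ (n : ℕ) (s : ℕ → Fin k), P'.real {ω | ∀ m ≤ n, V m ω = s m}
      = (if s 0 = i then 1 else 0) * ∏ m ∈ Finset.range n, p (s m) (s (m + 1))) (δ : ℝ) :
    IdentDistrib (rescaledWalk δ fun n ω => y (V n ω)) (rescaledWalk δ Y) P' P := by
  obtain ⟨f, hf, hfy⟩ := exists_measurable_leftInverse hy i
  have hWm : ∀ n, Measurable fun ω => f (Y n ω) := fun n => hf.comp (h.measurable n)
  have hW : ∀ᵐ ω ∂P, ∀ n, y (f (Y n ω)) = Y n ω := ae_all_iff.2 fun n => by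
    filter_upwards [h.mem_states n] with ω ⟨j, hj⟩
    rw [← hj, hfy]
  have hmap : P'.map (fun ω n => V n ω) = P.map (fun ω n => f (Y n ω)) := by
    refine map_eq_of_forall_prefix hV hWm fun n s => ?_
    rw [hVlaw, ← h.measureReal_prefix hy h0]
    refine measureReal_congr ?_
    filter_upwards [hW] with ω hω
    refine propext (forall₂_congr fun m _ => ?_)
    rw [← hy.eq_iff, hω]
  have hId : IdentDistrib (fun ω n => V n ω) (fun ω n => f (Y n ω)) P' P :=
    ⟨(measurable_pi_iff.2 hV).aemeasurable, (measurable_pi_iff.2 hWm).aemeasurable, hmap⟩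
  have h1 := hId.comp (measurable_rescaledWalk y δ)
  refine h1.trans (IdentDistrib.of_ae_eq h1.aemeasurable_snd ?_)
  filter_upwards [hW] with ω hω
  ext t
  simp [rescaledWalk, walk, hω]

/-! ### The interpolated walk as an integral of a step function. -/

theorem intervalIntegrable_of_bounded {f : ℝ → ℝ} (hf : Measurable f) {M : ℝ}
    (hM : ∀ s, |f s| ≤ M) (a b : ℝ) : IntervalIntegrable f volume a b := by
  refine (intervalIntegrable_const (c := M)).mono_fun hf.aestronglyMeasurable ?_
  exact Eventually.of_forall fun s => (hM s).trans (le_abs_self M)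

theorem integral_natFloor_of_mem_Icc (z : ℕ → ℝ) (n : ℕ) {v : ℝ} (hv : v ∈ Set.Icc (n : ℝ) (n + 1)) :
    ∫ w in (n : ℝ)..v, z ⌊w⌋₊ = (v - n) * z n := by
  -- The endpoint `v = n + 1` has floor `n + 1`, so the integrand is compared with a constant on the
  -- open interval only.
  rw [intervalIntegral.integral_of_le hv.1, integral_Ioc_eq_integral_Ioo,
    setIntegral_congr_fun (g := fun _ => z n) measurableSet_Ioo fun w hw => ?_,
    ← integral_Ioc_eq_integral_Ioo, ← intervalIntegral.integral_of_le hv.1,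
    intervalIntegral.integral_const, smul_eq_mul]
  have : ⌊w⌋₊ = n := (Nat.floor_eq_iff ((Nat.cast_nonneg n).trans hw.1.le)).2
    ⟨hw.1.le, hw.2.trans_le hv.2⟩
  rw [this]

theorem measurable_comp_natFloor (z : ℕ → ℝ) : Measurable fun w : ℝ => z ⌊w⌋₊ :=
  measurable_from_nat.comp Nat.measurable_floor

/-- The integral of a step function with steps of length `1`. -/
theorem integral_natFloor {z : ℕ → ℝ} {M : ℝ} (hz : ∀ n, |z n| ≤ M) {v : ℝ} (hv : 0 ≤ v) :
    ∫ w in (0 : ℝ)..v, z ⌊w⌋₊ = ∑ m ∈ Finset.range ⌊v⌋₊, z m + (v - ⌊v⌋₊) * z ⌊v⌋₊ := by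
  have hi : ∀ a b : ℝ, IntervalIntegrable (fun w : ℝ => z ⌊w⌋₊) volume a b :=
    intervalIntegrable_of_bounded (measurable_comp_natFloor z) fun _ => hz _
  have h1 : ∀ n : ℕ, ∫ w in (0 : ℝ)..n, z ⌊w⌋₊ = ∑ m ∈ Finset.range n, z m := fun n => by
    have := intervalIntegral.sum_integral_adjacent_intervals (n := n) (a := fun m : ℕ => (m : ℝ))
      fun m _ => hi m (m + 1 : ℕ)
    rw [Nat.cast_zero] at this
    rw [← this]
    refine Finset.sum_congr rfl fun m _ => ?_
    rw [integral_natFloor_of_mem_Icc z m ⟨by simp, by simp⟩]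
    simp
  rw [← intervalIntegral.integral_add_adjacent_intervals (hi 0 ⌊v⌋₊) (hi ⌊v⌋₊ v), h1,
    integral_natFloor_of_mem_Icc z _ ⟨Nat.floor_le hv, (Nat.lt_floor_add_one v).le⟩]

/-- The interpolated walk is the integral of a step function. -/
theorem rescaledWalk_apply_eq_integral {Ω : Type*} {Y : ℕ → Ω → ℝ} {ω : Ω} {M : ℝ}
    (hY : ∀ n, |Y n ω| ≤ M) {δ : ℝ} (hδ : 0 < δ) (t : ℝ≥0) :
    rescaledWalk δ Y ω t = δ * Y 0 ω + ∫ s in (0 : ℝ)..t, Y (⌊s / δ⌋₊ + 1) ω := by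
  have h1 : ((t / δ.toNNReal : ℝ≥0) : ℝ) = t / δ := by
    rw [NNReal.coe_div, Real.coe_toNNReal δ hδ.le]
  have h2 : ⌊t / δ.toNNReal⌋₊ = ⌊(t : ℝ) / δ⌋₊ := by
    rw [← h1]
    exact Nat.floor_eq_iff zero_le |>.2 ⟨by exact_mod_cast Nat.floor_le (NNReal.coe_nonneg _),
      by exact_mod_cast Nat.lt_floor_add_one ((t / δ.toNNReal : ℝ≥0) : ℝ)⟩
  rw [intervalIntegral.integral_comp_div (f := fun w => Y (⌊w⌋₊ + 1) ω) hδ.ne', zero_div,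
    integral_natFloor (z := fun n => Y (n + 1) ω) (fun n => hY (n + 1)) (by positivity)]
  have h3 : rescaledWalk δ Y ω t = linearInterp (fun n => δ * walk Y n ω) (t / δ.toNNReal) := rfl
  rw [h3, linearInterp, h1, h2]
  simp only [walk, smul_eq_mul]
  -- The walk already contains `Y 0` at time `0`, and its slope after time `n δ` is `Y (n + 1)`.
  -- This accounts for the term `δ * Y 0 ω` and the shifted index.
  rw [Finset.sum_range_succ _ (⌊(t : ℝ) / δ⌋₊ + 1), Finset.sum_range_succ' _ ⌊(t : ℝ) / δ⌋₊]
  ring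

/-! ### Pathwise convergence. -/

section Convergence

variable {k : ℕ} {y : Fin k → ℝ} {u : ℕ → Fin k} {η : ℕ → ℝ} {r : ℝ≥0 → ℝ}

/-- A path that runs through the states `y (u n)`, with holding times `η n`, is a measurable
selection of these states. -/
theorem exists_measurable_index
    (hsum : Tendsto (fun n => ∑ m ∈ Finset.range n, η m) atTop atTop)
    (hr : ∀ (n : ℕ) (t : ℝ≥0), ∑ m ∈ Finset.range n, η m ≤ t →
      t < ∑ m ∈ Finset.range (n + 1), η m → r t = y (u n)) :
    ∃ ν : ℝ → ℕ, Measurable ν ∧ (∀ s, r s.toNNReal = y (u (ν s))) ∧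
      ∀ s, 0 ≤ s → ∑ m ∈ Finset.range (ν s), η m ≤ s ∧
        s < ∑ m ∈ Finset.range (ν s + 1), η m := by
  classical
  -- Here `max s 0` is the real value of `s.toNNReal`. The first `n` whose interval ends after it
  -- indexes the interval that contains it.
  have hex : ∀ s : ℝ, ∃ n, max s 0 < ∑ m ∈ Finset.range (n + 1), η m := fun s =>
    ((hsum.comp (tendsto_add_atTop_nat 1)).eventually_gt_atTop (max s 0)).exists
  have hle : ∀ s : ℝ, ∑ m ∈ Finset.range (Nat.find (hex s)), η m ≤ max s 0 := fun s => by
    rcases h : Nat.find (hex s) with - | n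
    · simp
    · exact not_lt.1 (Nat.find_min (hex s) (m := n) (by omega))
  refine ⟨fun s => Nat.find (hex s), measurable_find hex fun n => ?_, fun s => ?_, fun s hs => ?_⟩
  · exact measurableSet_lt (measurable_id.max measurable_const) measurable_const
  · exact hr _ _ (hle s) (Nat.find_spec (hex s))
  · have h1 := hle s
    have h2 := Nat.find_spec (hex s)
    exact ⟨h1.trans_eq (max_eq_left hs), (le_max_left s 0).trans_lt h2⟩

theorem abs_le_sum_abs (y : Fin k → ℝ) (j : Fin k) : |y j| ≤ ∑ j, |y j| :=
  Finset.single_le_sum (f := fun j => |y j|) (fun _ _ => abs_nonneg _) (Finset.mem_univ j)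

theorem intervalIntegrable_path
    (hsum : Tendsto (fun n => ∑ m ∈ Finset.range n, η m) atTop atTop)
    (hr : ∀ (n : ℕ) (t : ℝ≥0), ∑ m ∈ Finset.range n, η m ≤ t →
      t < ∑ m ∈ Finset.range (n + 1), η m → r t = y (u n)) (a b : ℝ) :
    IntervalIntegrable (fun s : ℝ => r s.toNNReal) volume a b := by
  obtain ⟨ν, hν, hrν, -⟩ := exists_measurable_index hsum hr
  simp only [hrν]
  exact intervalIntegrable_of_bounded (f := fun s => y (u (ν s)))
    ((measurable_from_nat (f := fun n => y (u n))).comp hν)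
    (fun s => abs_le_sum_abs y _) a b

/-- The quotient is a difference quotient at `0` of `-log (1 - q δ) / q`, whose derivative there is
`1`. -/
theorem tendsto_stepHolding_div {c : Fin k → Fin k → ℝ} {j : Fin k} (hpos : 0 < exitRate c j) :
    Tendsto (fun δ => stepHolding c δ j / δ) (𝓝[>] 0) (𝓝 1) := by
  have h1 : HasDerivAt (fun δ => stepHolding c δ j) 1 0 := by
    have h2 : HasDerivAt (fun δ : ℝ => 1 - exitRate c j * δ) (-exitRate c j) 0 := by
      simpa using ((hasDerivAt_id (0 : ℝ)).const_mul (exitRate c j)).const_sub 1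
    have h3 := ((h2.log (by simp)).neg).div_const (exitRate c j)
    have h4 : -(-exitRate c j / (1 - exitRate c j * 0)) / exitRate c j = 1 := by
      rw [mul_zero, sub_zero, div_one, neg_neg, div_self hpos.ne']
    rw [h4] at h3
    exact h3
  have h2 := h1.tendsto_slope_zero_right
  refine h2.congr fun δ => ?_
  simp [stepHolding]
  ring

/-- Rounding up costs at most one unit, that is, at most `δ` after multiplication by `δ`, so the
limit follows by squeezing. -/
theorem tendsto_mul_natCeil {c : Fin k → Fin k → ℝ} {j : Fin k} (hpos : 0 < exitRate c j)
    {x : ℝ} (hx : 0 ≤ x) :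
    Tendsto (fun δ => δ * (⌈x / stepHolding c δ j⌉₊ : ℝ)) (𝓝[>] 0) (𝓝 x) := by
  have h0 : Tendsto (fun δ : ℝ => δ) (𝓝[>] 0) (𝓝 0) := tendsto_nhdsWithin_of_tendsto_nhds tendsto_id
  have h1 : Tendsto (fun δ => x / (stepHolding c δ j / δ)) (𝓝[>] 0) (𝓝 x) := by
    simpa [Pi.div_def] using
      (tendsto_const_nhds (x := x)).div (tendsto_stepHolding_div hpos) one_ne_zero
  have h2 : Tendsto (fun δ => x / (stepHolding c δ j / δ) + δ) (𝓝[>] 0) (𝓝 x) := by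
    simpa using h1.add h0
  have h3 : ∀ᶠ δ : ℝ in 𝓝[>] 0, exitRate c j * δ < 1 := by
    have : Tendsto (fun δ : ℝ => exitRate c j * δ) (𝓝[>] 0) (𝓝 0) := by
      simpa using h0.const_mul (exitRate c j)
    exact this.eventually_lt_const one_pos
  have heq : ∀ δ, x / (stepHolding c δ j / δ) = δ * (x / stepHolding c δ j) := fun δ => by
    rw [div_div_eq_mul_div]
    ring
  refine tendsto_of_tendsto_of_tendsto_of_le_of_le' h1 h2 ?_ ?_
  · filter_upwards [self_mem_nhdsWithin] with δ hδ
    rw [heq]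
    exact mul_le_mul_of_nonneg_left (Nat.le_ceil _) (le_of_lt hδ)
  · filter_upwards [self_mem_nhdsWithin, h3] with δ hδ hδ1
    have := (Nat.ceil_lt_add_one (div_nonneg hx (stepHolding_pos hpos hδ hδ1).le)).le
    rw [heq]
    calc _ ≤ δ * (x / stepHolding c δ j + 1) := mul_le_mul_of_nonneg_left this (le_of_lt hδ)
      _ = _ := by ring

/-- The rounded holding times determine, for small time steps, the state visited at a time that
is not a jump time. -/
theorem eventually_position_eq {c : Fin k → Fin k → ℝ} (hpos : ∀ j, 0 < exitRate c j)
    (hη : ∀ m, 0 < η m) {s : ℝ} (hs : 0 ≤ s) {j : ℕ}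
    (h1 : ∑ m ∈ Finset.range j, η m < s) (h2 : s < ∑ m ∈ Finset.range (j + 1), η m) :
    ∀ᶠ δ in 𝓝[>] (0 : ℝ),
      (position (fun m => ⌈η m / stepHolding c δ (u m)⌉₊) (⌊s / δ⌋₊ + 1)).1 = j := by
  have h0 : Tendsto (fun δ : ℝ => δ) (𝓝[>] 0) (𝓝 0) := tendsto_nhdsWithin_of_tendsto_nhds tendsto_id
  have hq : ∀ᶠ δ : ℝ in 𝓝[>] 0, ∀ j, exitRate c j * δ < 1 := eventually_all.2 fun j => by
    have : Tendsto (fun δ : ℝ => exitRate c j * δ) (𝓝[>] 0) (𝓝 0) := by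
      simpa using h0.const_mul (exitRate c j)
    exact this.eventually_lt_const one_pos
  have hlim : ∀ n, Tendsto
      (fun δ => δ * ((∑ m ∈ Finset.range n, ⌈η m / stepHolding c δ (u m)⌉₊ : ℕ) : ℝ))
      (𝓝[>] 0) (𝓝 (∑ m ∈ Finset.range n, η m)) := fun n => by
    simp only [Nat.cast_sum, Finset.mul_sum]
    exact tendsto_finsetSum _ fun m _ => tendsto_mul_natCeil (hpos _) (hη m).le
  -- The extra `δ` covers the shift in `⌊s / δ⌋₊ + 1`.
  have h4 : ∀ᶠ δ in 𝓝[>] (0 : ℝ), s + δ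
      < δ * ((∑ m ∈ Finset.range (j + 1), ⌈η m / stepHolding c δ (u m)⌉₊ : ℕ) : ℝ) := by
    refine Tendsto.eventually_lt (f := fun δ => s + δ) ?_ (hlim (j + 1)) h2
    simpa using h0.const_add s
  filter_upwards [self_mem_nhdsWithin, hq, (hlim j).eventually_lt_const h1, h4]
    with δ hδ hδ1 h5 h6
  have hδ : 0 < δ := hδ
  have h7 : (⌊s / δ⌋₊ : ℝ) ≤ s / δ := Nat.floor_le (by positivity)
  have h8 : s / δ < ⌊s / δ⌋₊ + 1 := Nat.lt_floor_add_one _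
  rw [le_div_iff₀ hδ] at h7
  rw [div_lt_iff₀ hδ] at h8
  refine position_fst_eq (fun m => Nat.ceil_pos.2
    (div_pos (hη m) (stepHolding_pos (hpos _) hδ (hδ1 _)))) ?_ ?_
  · rw [← Nat.cast_le (α := ℝ)]
    refine le_of_mul_le_mul_left ?_ hδ
    push_cast at h5 ⊢
    linarith
  · rw [← Nat.cast_lt (α := ℝ)]
    refine lt_of_mul_lt_mul_left ?_ hδ.le
    push_cast at h6 ⊢
    linarith

/-- Pathwise convergence of the rescaled walks to the integral of the path. -/
theorem tendsto_rescaledWalk {c : Fin k → Fin k → ℝ} (hpos : ∀ j, 0 < exitRate c j)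
    (hη : ∀ m, 0 < η m)
    (hsum : Tendsto (fun n => ∑ m ∈ Finset.range n, η m) atTop atTop)
    (hr : ∀ (n : ℕ) (t : ℝ≥0), ∑ m ∈ Finset.range n, η m ≤ t →
      t < ∑ m ∈ Finset.range (n + 1), η m → r t = y (u n)) {Ω : Type*} {ω : Ω}
    {Y : ℝ → ℕ → Ω → ℝ} (hY : ∀ δ n, Y δ n ω
      = y (u (position (fun m => ⌈η m / stepHolding c δ (u m)⌉₊) n).1)) :
    Tendsto (fun δ => rescaledWalk δ (Y δ) ω) (𝓝[>] 0) (𝓝 (integralPath r)) := by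
  obtain ⟨ν, hν, hrν, hspec⟩ := exists_measurable_index hsum hr
  have hint := intervalIntegrable_path hsum hr
  set M : ℝ := ∑ j, |y j|
  have hYM : ∀ δ n, |Y δ n ω| ≤ M := fun δ n => by
    rw [hY]
    exact abs_le_sum_abs y _
  have hgm : ∀ δ : ℝ, Measurable fun s : ℝ => Y δ (⌊s / δ⌋₊ + 1) ω := fun δ =>
    (measurable_comp_natFloor fun n => Y δ (n + 1) ω).comp (measurable_id.div_const δ)
  have hgi : ∀ δ a b, IntervalIntegrable (fun s : ℝ => Y δ (⌊s / δ⌋₊ + 1) ω) volume a b :=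
    fun δ => intervalIntegrable_of_bounded (hgm δ) fun s => hYM δ _
  have hfm : Measurable fun s : ℝ => r s.toNNReal := by
    simp only [hrν]
    exact (measurable_from_nat (f := fun n => y (u n))).comp hν
  have hfM : ∀ s : ℝ, |r s.toNNReal| ≤ M := fun s => by
    rw [hrν]
    exact abs_le_sum_abs y _
  have hpt : ∀ᵐ s : ℝ, 0 ≤ s →
      Tendsto (fun δ => |Y δ (⌊s / δ⌋₊ + 1) ω - r s.toNNReal|) (𝓝[>] 0) (𝓝 0) := by
    -- The jump times are countable, hence a null set. At any other time the difference is
    -- eventually equal to `0`.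
    have hne : ∀ᵐ s : ℝ, ∀ n, s ≠ ∑ m ∈ Finset.range n, η m :=
      ae_all_iff.2 fun n => Measure.ae_ne volume _
    filter_upwards [hne] with s hs hs0
    refine tendsto_const_nhds.congr' ?_
    filter_upwards [eventually_position_eq (u := u) hpos hη hs0
      (lt_of_le_of_ne (hspec s hs0).1 (hs _).symm) (hspec s hs0).2] with δ hδ
    rw [hY, hδ, hrν, sub_self, abs_zero]
  -- This quantity bounds the distance of the two paths at all `t ≤ T` simultaneously: `δ * M` for
  -- the initial term and the `L¹` distance of the integrands on `[0, T]`.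
  have hL1 : ∀ T : ℝ, 0 ≤ T → Tendsto
      (fun δ => δ * M + ∫ s in (0 : ℝ)..T, |Y δ (⌊s / δ⌋₊ + 1) ω - r s.toNNReal|)
      (𝓝[>] 0) (𝓝 0) := by
    intro T hT
    have h1 : Tendsto (fun δ : ℝ => δ * M) (𝓝[>] 0) (𝓝 0) := by
      have := (tendsto_nhdsWithin_of_tendsto_nhds tendsto_id :
        Tendsto (fun δ : ℝ => δ) (𝓝[>] 0) (𝓝 0)).mul_const M
      simpa using this
    have h2 := intervalIntegral.tendsto_integral_filter_of_dominated_convergence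
      (μ := volume) (a := 0) (b := T) (l := 𝓝[>] (0 : ℝ))
      (F := fun δ s => |Y δ (⌊s / δ⌋₊ + 1) ω - r s.toNNReal|) (f := fun _ => 0)
      (fun _ => M + M)
      (Eventually.of_forall fun δ => ((hgm δ).sub hfm).norm.aestronglyMeasurable)
      (Eventually.of_forall fun δ => Eventually.of_forall fun s _ => by
        rw [Real.norm_eq_abs, abs_abs]
        exact (abs_sub _ _).trans (add_le_add (hYM δ _) (hfM s)))
      intervalIntegrable_const
      (hpt.mono fun s hs hsI => by
        rw [Set.uIoc_of_le hT] at hsI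
        exact hs hsI.1.le)
    simpa using h1.add h2
  rw [ContinuousMap.tendsto_iff_forall_isCompact_tendstoUniformlyOn]
  intro K hK
  obtain ⟨T, hT⟩ := hK.bddAbove
  rw [Metric.tendstoUniformlyOn_iff]
  intro ε hε
  filter_upwards [self_mem_nhdsWithin, (hL1 T T.2).eventually_lt_const hε] with δ hδ hlt t ht
  have hδ : 0 < δ := hδ
  have htT : (t : ℝ) ≤ T := hT ht
  have hval : integralPath r t = ∫ s in (0 : ℝ)..t, r s.toNNReal := by
    rw [integralPath, dif_pos hint]
    rfl
  rw [dist_comm, Real.dist_eq, hval, rescaledWalk_apply_eq_integral (hYM δ) hδ, add_sub_assoc,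
    ← intervalIntegral.integral_sub (hgi δ _ _) (hint _ _)]
  refine lt_of_le_of_lt ((abs_add_le _ _).trans (add_le_add ?_ ?_)) hlt
  · rw [abs_mul, abs_of_pos hδ]
    exact mul_le_mul_of_nonneg_left (hYM δ 0) hδ.le
  · refine (intervalIntegral.abs_integral_le_integral_abs t.2).trans ?_
    refine intervalIntegral.integral_mono_interval le_rfl t.2 htT
      (Eventually.of_forall fun s => abs_nonneg _) ?_
    exact ((hgi δ _ _).sub (hint _ _)).abs

end Convergence

/-! ### The filter of vanishing time steps, and conclusion. -/

theorem tendsto_val_stepToZero {k : ℕ} (c : Fin k → Fin k → ℝ) :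
    Tendsto (fun δ : AdmissibleStep c => (δ : ℝ)) (stepToZero c) (𝓝[>] 0) :=
  tendsto_nhdsWithin_iff.2 ⟨tendsto_comap, Eventually.of_forall fun δ => δ.2.1⟩

/-- Finitely many strict bounds `a * δ < 1` all hold for small `δ > 0`. Nontriviality and countable
generation of the filter make an almost sure limit along it measurable. -/
instance neBot_stepToZero {k : ℕ} (c : Fin k → Fin k → ℝ) : (stepToZero c).NeBot := by
  rw [stepToZero, comap_neBot_iff]
  intro s hs
  have h0 : Tendsto (fun δ : ℝ => δ) (𝓝[>] 0) (𝓝 0) := tendsto_nhdsWithin_of_tendsto_nhds tendsto_id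
  have hmul : ∀ a : ℝ, ∀ᶠ δ in 𝓝[>] (0 : ℝ), a * δ < 1 := fun a => by
    have : Tendsto (fun δ : ℝ => a * δ) (𝓝[>] 0) (𝓝 0) := by simpa using h0.const_mul a
    exact this.eventually_lt_const one_pos
  have h1 : ∀ᶠ δ in 𝓝[>] (0 : ℝ), ∀ i j, c i j * δ < 1 :=
    eventually_all.2 fun i => eventually_all.2 fun j => hmul _
  have h2 : ∀ᶠ δ in 𝓝[>] (0 : ℝ), ∀ i, (∑ l, c i l) * δ < 1 := eventually_all.2 fun i => hmul _
  have h3 : ∀ᶠ δ in 𝓝[>] (0 : ℝ), 0 < δ := self_mem_nhdsWithin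
  obtain ⟨δ, hδs, hδ, hδ1, hδ2⟩ := ((h0.eventually_mem hs).and (h3.and (h1.and h2))).exists
  exact ⟨⟨δ, hδ, fun i j => (hδ1 i j).le, hδ2⟩, hδs⟩

instance isCountablyGenerated_stepToZero {k : ℕ} (c : Fin k → Fin k → ℝ) :
    (stepToZero c).IsCountablyGenerated :=
  inferInstanceAs (comap _ _).IsCountablyGenerated

end PersistentWalk

theorem theorem4p1 {k : ℕ} (hk : 2 ≤ k)
    (y : Fin k → ℝ) (hy : Function.Injective y)
    (c : Fin k → Fin k → ℝ)
    (hc_nonneg : ∀ i j, i ≠ j → 0 ≤ c i j)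
    (hc_diag : ∀ i, c i i = 0)
    (hc_pos : ∀ i, 0 < ∑ l, c i l)
    (i : Fin k)
    -- the increment chains, one for each small time step
    {Ω : PersistentWalk.AdmissibleStep c → Type*}
    [∀ δ, MeasurableSpace (Ω δ)]
    (P : ∀ δ, Measure (Ω δ)) [∀ δ, IsProbabilityMeasure (P δ)]
    (Y : ∀ δ, ℕ → Ω δ → ℝ)
    (hY : ∀ δ : PersistentWalk.AdmissibleStep c,
      PersistentWalk.IsMarkovChain y (PersistentWalk.transitionMatrix c (δ : ℝ)) (P δ) (Y δ))
    (hY0 : ∀ δ, ∀ᵐ ω ∂(P δ), Y δ 0 ω = y i)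
    -- the continuous-time chain
    {Ω' : Type*} [MeasurableSpace Ω'] (P' : Measure Ω') [IsProbabilityMeasure P']
    (R : ℝ≥0 → Ω' → ℝ) (hR : PersistentWalk.IsJumpProcess y c i P' R) :
    (∀ᵐ ω ∂P', ∀ a b : ℝ, IntervalIntegrable (fun s : ℝ => R s.toNNReal ω) volume a b) ∧
    TendstoInDistribution
      (fun (δ : PersistentWalk.AdmissibleStep c) ω => PersistentWalk.rescaledWalk (δ : ℝ) (Y δ) ω)
      (PersistentWalk.stepToZero c)
      (fun ω => PersistentWalk.integralPath (fun t => R t ω))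
      P P' := by
  obtain ⟨U, H, hU, hH, hlaw, hRUH⟩ := hR.exists_jump_chain
  have hchain : PersistentWalk.IsJumpChain c i P' U H := ⟨hU, hH, hlaw⟩
  have hpos : ∀ j, 0 < PersistentWalk.exitRate c j := hc_pos
  have hgood := (hchain.ae_holding_pos hpos).and ((hchain.ae_tendsto_sum_holding hpos).and hRUH)
  refine ⟨hgood.mono fun ω hω => PersistentWalk.intervalIntegrable_path hω.2.1 hω.2.2, ?_⟩
  -- The coupled chains, for all time steps at once on the space of `R`.
  set V : ℝ → ℕ → Ω' → ℝ := fun δ n ω => y (PersistentWalk.discretizedChain c δ U H n ω) with hV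
  have hid : ∀ δ : PersistentWalk.AdmissibleStep c,
      IdentDistrib (PersistentWalk.rescaledWalk (δ : ℝ) (V δ))
        (PersistentWalk.rescaledWalk (δ : ℝ) (Y δ)) P' (P δ) := fun δ =>
    PersistentWalk.identDistrib_rescaledWalk hy (hY δ) (hY0 δ)
      (hchain.measurable_discretizedChain δ)
      (hchain.measureReal_discretizedChain hpos hc_diag δ.2.1 δ.2.2.2) δ
  have hlim : ∀ᵐ ω ∂P', Tendsto
      (fun δ : PersistentWalk.AdmissibleStep c => PersistentWalk.rescaledWalk (δ : ℝ) (V δ) ω)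
      (PersistentWalk.stepToZero c) (𝓝 (PersistentWalk.integralPath fun t => R t ω)) := by
    filter_upwards [hgood] with ω hω
    exact (PersistentWalk.tendsto_rescaledWalk hpos hω.1 hω.2.1 hω.2.2
      (Y := V) fun δ n => rfl).comp (PersistentWalk.tendsto_val_stepToZero c)
  have hmeas := fun δ => (hid δ).aemeasurable_fst
  -- The limit inherits measurability from the coupled walks, so no joint measurability of `R` in
  -- time and `ω` is needed.
  have hZ : AEMeasurable (fun ω => PersistentWalk.integralPath fun t => R t ω) P' :=
    aemeasurable_of_tendsto_metrizable_ae (PersistentWalk.stepToZero c) hmeas hlim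
  have hconv := tendstoInDistribution_of_ae_tendsto hmeas hZ hlim
  refine ⟨fun δ => (hid δ).aemeasurable_snd, hZ, ?_⟩
  -- Convergence in distribution involves only the laws, and for each `δ` the coupled and the given
  -- walk have the same law.
  refine hconv.tendsto.congr fun δ => Subtype.ext ?_
  exact (hid δ).map_eq
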